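/- For a polynomial $P\in\mathbb{C}[x]$ of degree $n$ and an $m$-tuple $\Lambda=(\lambda_1,\dots,\lambda_m)$ of distinct complex numbers, the dope matrix of $P$ with respect to $\Lambda$ is the $m\times(n+1)$ $\{0,1\}$-matrix $D_P(\Lambda)=(\delta_{ij})_{i\in[1,m],\,j\in[0,n]}$, where $\delta_{ij}=1$ if the $j$-th derivative satisfies $P^{(j)}(\lambda_i)=0$, and $\delta_{ij}=0$ otherwise. An $m\times(n+1)$ $\{0,1\}$-matrix is called dope if it equals $D_P(\Lambda)$ for some such $P$ of degree $n$ and some such $\Lambda$. Let $m\ge 2$ and $n\ge 1$. The number of $m\times(n+1)$ dope matrices is at most $$\binom{2n+1}{n}^{m/2},$$ and moreover $$\binom{2n+1}{n}^{m/2}\le\left(\frac{2}{\sqrt{\pi n}}\right)^{m/2}2^{mn}.$$ -/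

import Mathlib

open Polynomial

open Classical in
/-- The dope matrix `D_P(Λ)` of a polynomial `P` with respect to an `m`-tuple `Λ` of complex numbers,
as an `m × (n + 1)` matrix with entries in `{0, 1}`: the entry in row `i` and column
`j ∈ {0, …, n}` is `1` if the `j`-th derivative of `P` vanishes at `Λ i`, and `0` otherwise.
It is used for `P` of degree `n` and `Λ` injective. -/
noncomputable def dopeMatrix {m : ℕ} (n : ℕ) (P : ℂ[X]) (Λ : Fin m → ℂ) :
    Matrix (Fin m) (Fin (n + 1)) (Fin 2) :=
  Matrix.of fun i j => if (derivative^[(j : ℕ)] P).eval (Λ i) = 0 then 1 else 0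

/-- The set `𝒟_n(Λ)` of the `m × (n + 1)` dope matrices arising from the tuple `Λ`. -/
def dopeMatricesOf {m : ℕ} (n : ℕ) (Λ : Fin m → ℂ) :
    Set (Matrix (Fin m) (Fin (n + 1)) (Fin 2)) :=
  {D | ∃ P : ℂ[X], P.degree = (n : WithBot ℕ) ∧ D = dopeMatrix n P Λ}

/-- The set `𝒟_n^m` of all `m × (n + 1)` dope matrices: those of the form `D_P(Λ)` with `P` of
degree exactly `n` and `Λ` an `m`-tuple of distinct complex numbers. -/
def dopeMatrices (m n : ℕ) : Set (Matrix (Fin m) (Fin (n + 1)) (Fin 2)) :=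
  {D | ∃ Λ : Fin m → ℂ, Function.Injective Λ ∧ D ∈ dopeMatricesOf n Λ}

/-!
The bound comes from a constraint on every pair of rows of a dope matrix.

*Two rows.* Let `P` have degree `n`, and look at its derivatives at two points. An affine change of
variable moves these points to `0` and `1`; after making `P` monic, the real part of `P` is a real
polynomial of degree `n` with at least the same vanishing derivatives
(`exists_real_polynomial_vanishing`). By Rolle's theorem, the number of distinct roots of the `k`-th
derivative in `(0, 1)`, plus the number of its zeros among the endpoints, is at most one more than
the number of roots of the next derivative in `(0, 1)`. Telescoping down from the nonzero constant
`P⁽ⁿ⁾` shows that the columns `j, …, n` of the two rows contain at most `n - j` ones in total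
(`sum_vanishing_add_numRootsIoo_le`).

*Counting pairs.* Read from the last column, such pairs of rows start with a zero column, and the
other columns form a walk of `n` steps `+1, 0, 0, -1` staying nonnegative. The reflection principle
counts these walks by `(2n).choose n + (2n).choose (n + 1) = (2n + 1).choose n`; here it takes the
form of a recursion in the length and the starting height (`reflectionCount_succ_succ`,
`card_ballotSeqs_le`).

*All rows.* If every pair of rows lies in a set `G`, then splitting off two rows costs a factor
`#G`, and for three rows the Loomis–Whitney inequality gives at most `(#G) ^ (3 / 2)` choices.
Combining the two covers both parities of `m` (`card_pairwiseTuples_sq_le`).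

The explicit upper estimate follows from `(2n + 1).choose n ≤ 2 * (2n).choose n` and the bound
`(2n).choose n ≤ 4 ^ n / √(π n)`, which is one side of Wallis' product inequality.
-/

/-! ### Rolle's theorem and two real nodes -/

/-- The number of distinct roots of a real polynomial in the open interval `(0, 1)`. -/
noncomputable def numRootsIoo (p : ℝ[X]) : ℕ :=
  (p.roots.toFinset.filter (fun x => x ∈ Set.Ioo (0 : ℝ) 1)).card

open Classical in
/-- Rolle's theorem as a count: consecutive roots in `[0, 1]` are separated by roots of the
derivative in `(0, 1)`. -/
theorem numRootsIoo_add_le_derivative {p : ℝ[X]} (hp : p ≠ 0) :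
    numRootsIoo p + ((if p.eval 0 = 0 then 1 else 0) + (if p.eval 1 = 0 then 1 else 0)) ≤
      numRootsIoo (derivative p) + 1 := by
  have hclosed : numRootsIoo p +
      ((if p.eval 0 = 0 then 1 else 0) + (if p.eval 1 = 0 then 1 else 0)) ≤
      (p.roots.toFinset.filter (fun x => x ∈ Set.Icc (0 : ℝ) 1)).card := by
    have h0 : (if p.eval 0 = 0 then 1 else 0) =
        (p.roots.toFinset.filter (fun x => x = 0)).card := by
      rw [Finset.filter_eq']
      simp [hp, apply_ite Finset.card]
    have h1 : (if p.eval 1 = 0 then 1 else 0) =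
        (p.roots.toFinset.filter (fun x => x = 1)).card := by
      rw [Finset.filter_eq']
      simp [hp, apply_ite Finset.card]
    rw [h0, h1, numRootsIoo, ← Finset.card_union_of_disjoint, ← Finset.card_union_of_disjoint]
    · refine Finset.card_le_card fun x hx => ?_
      simp only [Finset.mem_union, Finset.mem_filter, Set.mem_Ioo, Set.mem_Icc] at hx ⊢
      rcases hx with ⟨h, h0, h1⟩ | ⟨h, rfl⟩ | ⟨h, rfl⟩
      · exact ⟨h, h0.le, h1.le⟩
      · exact ⟨h, le_rfl, zero_le_one⟩
      · exact ⟨h, zero_le_one, le_rfl⟩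
    · rw [Finset.disjoint_left]
      intro x hx hx'
      simp only [Finset.mem_union, Finset.mem_filter, Set.mem_Ioo] at hx hx'
      rcases hx' with ⟨-, rfl⟩ | ⟨-, rfl⟩
      · exact lt_irrefl _ hx.2.1
      · exact lt_irrefl _ hx.2.2
    · rw [Finset.disjoint_left]
      intro x hx hx'
      simp only [Finset.mem_filter] at hx hx'
      exact zero_ne_one (hx.2.symm.trans hx'.2)
  refine hclosed.trans ?_
  rcases eq_or_ne (derivative p) 0 with hp' | hp'
  · rw [eq_C_of_derivative_eq_zero hp']
    simp
  refine Finset.card_le_of_interleaved fun x hx y hy hxy _ => ?_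
  simp only [Finset.mem_filter, Multiset.mem_toFinset, mem_roots hp, Set.mem_Icc] at hx hy
  obtain ⟨z, hz1, hz2⟩ := exists_deriv_eq_zero hxy p.continuousOn (hx.1.trans hy.1.symm)
  refine ⟨z, ?_, hz1⟩
  simp only [Finset.mem_filter, Multiset.mem_toFinset, mem_roots hp', Set.mem_Ioo]
  refine ⟨?_, hx.2.1.trans_lt hz1.1, hz1.2.trans_le hy.2.2⟩
  rwa [IsRoot, ← p.deriv]

theorem iterate_derivative_ne_zero_of_coeff_ne_zero {R : ℝ[X]} {n k : ℕ} (hR : R.coeff n ≠ 0)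
    (hk : k ≤ n) : derivative^[k] R ≠ 0 := by
  intro h
  have h' := congrArg (fun q => q.coeff (n - k)) h
  simp only [coeff_iterate_derivative, Nat.sub_add_cancel hk, coeff_zero, nsmul_eq_mul,
    mul_eq_zero, Nat.cast_eq_zero, hR, or_false] at h'
  exact (Nat.descFactorial_eq_zero_iff_lt.not.2 (by omega)) h'

open Classical in
/-- Telescoping Rolle's theorem from the constant `n`-th derivative downwards. -/
theorem sum_vanishing_add_numRootsIoo_le {R : ℝ[X]} {n : ℕ} (hdeg : R.natDegree ≤ n)
    (hR : R.coeff n ≠ 0) (i : ℕ) (hi : i ≤ n) :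
    ∑ j ∈ Finset.range (i + 1),
      ((if (derivative^[n - j] R).eval 0 = 0 then 1 else 0) +
        (if (derivative^[n - j] R).eval 1 = 0 then 1 else 0)) +
      numRootsIoo (derivative^[n - i] R) ≤ i := by
  induction i with
  | zero =>
    have hne := iterate_derivative_ne_zero_of_coeff_ne_zero hR le_rfl
    have hC : derivative^[n] R = C ((derivative^[n] R).coeff 0) :=
      eq_C_of_natDegree_le_zero ((natDegree_iterate_derivative R n).trans (by omega))
    simp only [zero_add, Finset.sum_range_one, Nat.sub_zero]
    generalize derivative^[n] R = q at hne hC ⊢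
    obtain ⟨c, rfl⟩ : ∃ c, q = C c := ⟨_, hC⟩
    have hc : c ≠ 0 := fun h => hne (by rw [h, C_0])
    simp [numRootsIoo, hc]
  | succ i ih =>
    have hstep := numRootsIoo_add_le_derivative
      (iterate_derivative_ne_zero_of_coeff_ne_zero hR (Nat.sub_le n (i + 1)))
    rw [← Function.iterate_succ_apply' (⇑derivative), show (n - (i + 1)).succ = n - i by omega] at hstep
    have := ih (by omega)
    rw [Finset.sum_range_succ]
    omega

/-! ### Reduction from complex to real polynomials -/

/-- The real polynomial whose coefficients are the real parts of those of `p`. -/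
noncomputable def rePoly (p : ℂ[X]) : ℝ[X] :=
  ∑ i ∈ Finset.range (p.natDegree + 1), monomial i (p.coeff i).re

theorem coeff_rePoly (p : ℂ[X]) (k : ℕ) : (rePoly p).coeff k = (p.coeff k).re := by
  simp only [rePoly, finsetSum_coeff, coeff_monomial, Finset.sum_ite_eq', Finset.mem_range]
  split_ifs with h
  · rfl
  · rw [coeff_eq_zero_of_natDegree_lt (by omega), Complex.zero_re]

theorem natDegree_rePoly_le (p : ℂ[X]) : (rePoly p).natDegree ≤ p.natDegree := by
  refine natDegree_le_iff_coeff_eq_zero.2 fun k hk => ?_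
  rw [coeff_rePoly, coeff_eq_zero_of_natDegree_lt hk, Complex.zero_re]

theorem iterate_derivative_rePoly (p : ℂ[X]) (k : ℕ) :
    derivative^[k] (rePoly p) = rePoly (derivative^[k] p) := by
  ext i
  simp [coeff_iterate_derivative, coeff_rePoly]

theorem eval_rePoly (p : ℂ[X]) (x : ℝ) : (rePoly p).eval x = (p.eval (x : ℂ)).re := by
  rw [eval_eq_sum_range' (Nat.lt_succ_of_le (natDegree_rePoly_le p)), eval_eq_sum_range,
    Complex.re_sum]
  refine Finset.sum_congr rfl fun i _ => ?_
  rw [coeff_rePoly, ← Complex.ofReal_pow, Complex.re_mul_ofReal]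

theorem iterate_derivative_comp_affine (P : ℂ[X]) (a μ : ℂ) (k : ℕ) :
    derivative^[k] (P.comp (C a + C μ * X)) =
      C (μ ^ k) * (derivative^[k] P).comp (C a + C μ * X) := by
  induction k with
  | zero => simp
  | succ k ih =>
    rw [Function.iterate_succ_apply', ih, Function.iterate_succ_apply']
    rw [derivative_C_mul, derivative_comp, derivative_add, derivative_C, derivative_C_mul,
      derivative_X, pow_succ, C_mul]
    ring

/-- An affine change of variable taking `0, 1` to `a, b`, a normalization of the leading
coefficient and passage to real parts reduce two complex nodes to the real nodes `0` and `1`. -/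
theorem exists_real_polynomial_vanishing {P : ℂ[X]} {n : ℕ} (hP : P.degree = n) {a b : ℂ}
    (hab : a ≠ b) :
    ∃ R : ℝ[X], R.natDegree ≤ n ∧ R.coeff n ≠ 0 ∧
      (∀ k, (derivative^[k] P).eval a = 0 → (derivative^[k] R).eval 0 = 0) ∧
      (∀ k, (derivative^[k] P).eval b = 0 → (derivative^[k] R).eval 1 = 0) := by
  have hμ : b - a ≠ 0 := sub_ne_zero.2 hab.symm
  have hn : P.natDegree = n := natDegree_eq_of_degree_eq_some hP
  have hP0 : P ≠ 0 := fun h => by simp [h] at hP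
  have hL : (C a + C (b - a) * X).natDegree = 1 := by
    rw [add_comm]; exact natDegree_linear hμ
  have hLl : (C a + C (b - a) * X).leadingCoeff = b - a := by
    rw [add_comm]; exact leadingCoeff_linear hμ
  set Q : ℂ[X] := P.comp (C a + C (b - a) * X) with hQ
  have hQn : Q.natDegree = n := by rw [hQ, natDegree_comp, hL, hn, mul_one]
  have hQc : Q.coeff n ≠ 0 := by
    rw [← hQn, coeff_natDegree, hQ, leadingCoeff_comp (by rw [hL]; exact one_ne_zero), hLl]
    exact mul_ne_zero (leadingCoeff_ne_zero.2 hP0) (pow_ne_zero _ hμ)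
  refine ⟨rePoly (C (Q.coeff n)⁻¹ * Q), ?_, ?_, ?_, ?_⟩
  · exact (natDegree_rePoly_le _).trans ((natDegree_C_mul_le _ _).trans hQn.le)
  · rw [coeff_rePoly, coeff_C_mul, inv_mul_cancel₀ hQc]
    simp
  · intro k hk
    rw [iterate_derivative_rePoly, eval_rePoly, iterate_derivative_C_mul, hQ,
      iterate_derivative_comp_affine]
    simp [hk]
  · intro k hk
    rw [iterate_derivative_rePoly, eval_rePoly, iterate_derivative_C_mul, hQ,
      iterate_derivative_comp_affine]
    simp [hk]

/-! ### Counting ballot sequences -/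

/-- The number of ones in a pair of `{0, 1}` entries, that is, in one column of two rows. -/
def columnWeight (p : Fin 2 × Fin 2) : ℕ := (p.1 : ℕ) + (p.2 : ℕ)

/-- Sequences of `n` columns of two `{0, 1}` entries whose initial segments have total weight
exceeding their length by at most `s - 1`; for `s = 0` the weight stays below the length. In terms
of walks with steps `1 - columnWeight`, the walk started at height `s - 1` stays nonnegative from
its first step on. -/
def ballotSeqs (n s : ℕ) : Finset (Fin n → Fin 2 × Fin 2) :=
  Finset.univ.filter fun x =>
    ∀ i : Fin n, ∑ j, (if j ≤ i then columnWeight (x j) else 0) ≤ s + (i : ℕ)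

theorem head_and_tail_of_mem_ballotSeqs {n s : ℕ} {x : Fin (n + 1) → Fin 2 × Fin 2}
    (hx : x ∈ ballotSeqs (n + 1) s) :
    columnWeight (x 0) ≤ s ∧ Fin.tail x ∈ ballotSeqs n (s + 1 - columnWeight (x 0)) := by
  simp only [ballotSeqs, Finset.mem_filter, Finset.mem_univ, true_and] at hx ⊢
  have h0 : columnWeight (x 0) ≤ s := by
    have := hx 0
    rw [Fin.sum_univ_succ] at this
    simpa using this
  refine ⟨h0, fun i => ?_⟩
  have := hx i.succ
  rw [Fin.sum_univ_succ] at this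
  simp only [Fin.zero_le, if_true, Fin.succ_le_succ_iff, Fin.val_succ] at this
  simp only [Fin.tail]
  omega

theorem card_ballotSeqs_succ_le (n s : ℕ) :
    (ballotSeqs (n + 1) s).card ≤ ∑ p : Fin 2 × Fin 2,
      if columnWeight p ≤ s then (ballotSeqs n (s + 1 - columnWeight p)).card else 0 := by
  rw [Finset.card_eq_sum_card_fiberwise (f := fun x => x 0) (t := Finset.univ)
    (fun _ _ => Finset.mem_coe.2 (Finset.mem_univ _))]
  refine Finset.sum_le_sum fun p _ => ?_
  split_ifs with hp
  · refine Finset.card_le_card_of_injOn Fin.tail ?_ ?_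
    · intro x hx
      obtain ⟨hx', rfl⟩ := Finset.mem_filter.1 hx
      exact (head_and_tail_of_mem_ballotSeqs hx').2
    · intro x hx y hy hxy
      have hx0 := (Finset.mem_filter.1 hx).2
      have hy0 := (Finset.mem_filter.1 hy).2
      rw [← Fin.cons_self_tail x, ← Fin.cons_self_tail y, hxy]
      exact congrArg (fun q => (Fin.cons q (Fin.tail y) : Fin (n + 1) → Fin 2 × Fin 2))
        (hx0.trans hy0.symm)
  · rw [Nat.le_zero, Finset.card_eq_zero, Finset.filter_eq_empty_iff]
    rintro x hx rfl
    exact hp (head_and_tail_of_mem_ballotSeqs hx).1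

/-- The binomial coefficient `(2n).choose (n + d)` for an integer offset `d`, zero when
`n + d < 0`. It counts the free walks of `n` double steps with displacement `d`. -/
def centeredChoose (n : ℕ) (d : ℤ) : ℕ :=
  if 0 ≤ (n : ℤ) + d then (2 * n).choose ((n : ℤ) + d).toNat else 0

theorem centeredChoose_succ (n : ℕ) (d : ℤ) :
    centeredChoose (n + 1) d =
      centeredChoose n (d - 1) + 2 * centeredChoose n d + centeredChoose n (d + 1) := by
  unfold centeredChoose
  rcases lt_or_ge ((n : ℤ) + 1 + d) 0 with h | h
  · rw [if_neg (by push_cast; omega), if_neg (by omega), if_neg (by omega), if_neg (by omega)]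
  obtain ⟨t, ht⟩ := Int.eq_ofNat_of_zero_le h
  rw [show ((n + 1 : ℕ) : ℤ) + d = t by push_cast; exact ht, show (n : ℤ) + (d + 1) = t by omega,
    show (n : ℤ) + d = t - 1 by omega, show (n : ℤ) + (d - 1) = t - 2 by omega]
  rcases t with _ | _ | t
  · simp
  · simp
    omega
  · rw [if_pos (by omega), if_pos (by omega), if_pos (by omega), if_pos (by omega),
      show (((t + 1 + 1 : ℕ) : ℤ)).toNat = t + 2 by omega,
      show (((t + 1 + 1 : ℕ) : ℤ) - 1).toNat = t + 1 by omega,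
      show (((t + 1 + 1 : ℕ) : ℤ) - 2).toNat = t by omega,
      show 2 * (n + 1) = 2 * n + 1 + 1 by ring, Nat.choose_succ_succ', Nat.choose_succ_succ',
      Nat.choose_succ_succ' (2 * n) (t + 1)]
    ring

/-- The reflection-principle count of walks staying nonnegative: the sum of the centered binomial
coefficients with offsets from `1 - s` to `s`. -/
def reflectionCount (n s : ℕ) : ℕ :=
  ∑ k ∈ Finset.range s, (centeredChoose n (-(k : ℤ)) + centeredChoose n ((k : ℤ) + 1))

theorem reflectionCount_succ_succ (n s : ℕ) :
    reflectionCount (n + 1) (s + 1) =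
      reflectionCount n (s + 2) + 2 * reflectionCount n (s + 1) + reflectionCount n s := by
  induction s with
  | zero =>
    simp [reflectionCount, Finset.sum_range_succ, centeredChoose_succ]
    ring
  | succ s ih =>
    have hsucc : ∀ n s, reflectionCount n (s + 1) = reflectionCount n s +
        (centeredChoose n (-(s : ℤ)) + centeredChoose n ((s : ℤ) + 1)) :=
      fun n s => Finset.sum_range_succ _ _
    rw [hsucc (n + 1) (s + 1), ih, hsucc n (s + 2), hsucc n (s + 1), hsucc n s,
      centeredChoose_succ, centeredChoose_succ]
    push_cast
    rw [show -((s : ℤ) + 1) - 1 = -((s : ℤ) + 2) by ring,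
      show -((s : ℤ) + 1) + 1 = -(s : ℤ) by ring,
      show (s : ℤ) + 1 + 1 - 1 = (s : ℤ) + 1 by ring,
      show (s : ℤ) + 1 + 1 + 1 = (s : ℤ) + 2 + 1 by ring]
    ring

theorem card_ballotSeqs_le (n s : ℕ) :
    (ballotSeqs n (s + 1)).card ≤ reflectionCount n (s + 1) := by
  induction n generalizing s with
  | zero =>
    have h1 : (ballotSeqs 0 (s + 1)).card ≤ 1 := (Finset.card_le_univ _).trans (by simp)
    refine h1.trans ?_
    have h2 : 1 ≤ centeredChoose 0 (-((0 : ℕ) : ℤ)) + centeredChoose 0 (((0 : ℕ) : ℤ) + 1) := by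
      decide
    exact h2.trans (Finset.single_le_sum
      (f := fun k : ℕ => centeredChoose 0 (-(k : ℤ)) + centeredChoose 0 ((k : ℤ) + 1))
      (fun _ _ => Nat.zero_le _) (Finset.mem_range.2 (Nat.succ_pos s)))
  | succ n ih =>
    refine (card_ballotSeqs_succ_le n (s + 1)).trans ?_
    rw [reflectionCount_succ_succ, Fintype.sum_prod_type]
    simp only [Fin.sum_univ_two, columnWeight]
    have h2 := ih (s + 1)
    have h1 := ih s
    -- A column of weight two is excluded when the walk starts at height `0`.
    rcases s with _ | s
    · simp [reflectionCount] at h1 h2 ⊢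
      omega
    · have h0 := ih s
      simp at h0 h1 h2 ⊢
      rw [show s + 1 + 2 = s + 1 + 1 + 1 from rfl]
      omega

/-- For `s = 0` the first column is forced to be zero, and the other `n` columns form a sequence
with `s = 1`. -/
theorem card_ballotSeqs_zero_le (n : ℕ) :
    (ballotSeqs (n + 1) 0).card ≤ (2 * n + 1).choose n := by
  refine (card_ballotSeqs_succ_le n 0).trans ?_
  rw [Fintype.sum_prod_type]
  simp only [Fin.sum_univ_two, columnWeight]
  have h := card_ballotSeqs_le n 0
  have h2 : reflectionCount n 1 = (2 * n + 1).choose n := by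
    rw [← Nat.choose_symm_half n, Nat.choose_succ_succ']
    simp only [reflectionCount, Finset.sum_range_one, centeredChoose]
    rw [if_pos (by omega), if_pos (by omega)]
    norm_num
  simpa [h2] using h

/-! ### Pairs of rows of a dope matrix -/

/-- The pairs of rows of length `n + 1` which, read from the last column to the first, form a
ballot sequence. -/
def ballotPairs (n : ℕ) : Finset ((Fin (n + 1) → Fin 2) × (Fin (n + 1) → Fin 2)) :=
  Finset.univ.filter fun p => (fun i => (p.1 i.rev, p.2 i.rev)) ∈ ballotSeqs (n + 1) 0

theorem card_ballotPairs_le (n : ℕ) : (ballotPairs n).card ≤ (2 * n + 1).choose n := by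
  refine le_trans (Finset.card_le_card_of_injOn (fun p i => (p.1 i.rev, p.2 i.rev))
    (fun p hp => (Finset.mem_filter.1 hp).2) ?_) (card_ballotSeqs_zero_le n)
  intro p _ q _ h
  have h' : ∀ i : Fin (n + 1), (p.1 i, p.2 i) = (q.1 i, q.2 i) := fun i => by
    simpa using congrFun h i.rev
  exact Prod.ext (funext fun i => (Prod.ext_iff.1 (h' i)).1)
    (funext fun i => (Prod.ext_iff.1 (h' i)).2)

/-- The two-row constraint on dope matrices. -/
theorem rows_mem_ballotPairs {m n : ℕ} {D : Matrix (Fin m) (Fin (n + 1)) (Fin 2)}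
    (hD : D ∈ dopeMatrices m n) {a b : Fin m} (hab : a ≠ b) : (D a, D b) ∈ ballotPairs n := by
  classical
  obtain ⟨Λ, hΛ, P, hP, rfl⟩ := hD
  obtain ⟨R, hdeg, hR, h0, h1⟩ := exists_real_polynomial_vanishing hP (hΛ.ne hab)
  simp only [ballotPairs, ballotSeqs, Finset.mem_filter, Finset.mem_univ, true_and]
  intro i
  have hi := sum_vanishing_add_numRootsIoo_le hdeg hR i (by omega)
  rw [zero_add]
  refine le_trans ?_ ((Nat.le_add_right _ _).trans hi)
  -- Compare entrywise: every vanishing recorded by the matrix is a vanishing of `R`.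
  let f : ℕ → ℕ := fun j =>
    (if (derivative^[n - j] R).eval 0 = 0 then 1 else 0) +
      (if (derivative^[n - j] R).eval 1 = 0 then 1 else 0)
  have hf : ∀ j : Fin (n + 1),
      columnWeight (dopeMatrix n P Λ a j.rev, dopeMatrix n P Λ b j.rev) ≤ f j := by
    intro j
    have hj : ((j.rev : Fin (n + 1)) : ℕ) = n - j := by rw [Fin.val_rev]; omega
    simp only [columnWeight, dopeMatrix, Matrix.of_apply, hj, f]
    refine add_le_add ?_ ?_
    · by_cases h : (derivative^[n - (j : ℕ)] P).eval (Λ a) = 0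
      · simp [h, h0 _ h]
      · simp [h]
    · by_cases h : (derivative^[n - (j : ℕ)] P).eval (Λ b) = 0
      · simp [h, h1 _ h]
      · simp [h]
  calc ∑ j, (if j ≤ i then
        columnWeight (dopeMatrix n P Λ a j.rev, dopeMatrix n P Λ b j.rev) else 0)
      ≤ ∑ j : Fin (n + 1), (if (j : ℕ) ≤ (i : ℕ) then f j else 0) := by
        refine Finset.sum_le_sum fun j _ => ?_
        simp only [← Fin.le_def]
        split_ifs
        · exact hf j
        · exact le_rfl
    _ = ∑ j ∈ Finset.range (n + 1), (if j ≤ (i : ℕ) then f j else 0) :=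
        Fin.sum_univ_eq_sum_range (fun j => if j ≤ (i : ℕ) then f j else 0) (n + 1)
    _ = ∑ j ∈ Finset.range ((i : ℕ) + 1), f j := by
        rw [← Finset.sum_filter]
        refine Finset.sum_congr ?_ fun _ _ => rfl
        ext j
        simp only [Finset.mem_filter, Finset.mem_range]
        omega

/-! ### From pairs of rows to all rows -/

section Pairwise

variable {α : Type*} [Fintype α] [DecidableEq α]

/-- The `m`-tuples all of whose ordered pairs of entries at distinct positions lie in `G`. -/
def pairwiseTuples (G : Finset (α × α)) (m : ℕ) : Finset (Fin m → α) :=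
  Finset.univ.filter fun f => ∀ a b, a ≠ b → (f a, f b) ∈ G

theorem card_pairwiseTuples_add_two_le (G : Finset (α × α)) (m : ℕ) :
    (pairwiseTuples G (m + 2)).card ≤ G.card * (pairwiseTuples G m).card := by
  rw [← Finset.card_product]
  refine Finset.card_le_card_of_injOn
    (fun f => ((f 0, f 1), fun i => f i.succ.succ)) ?_ ?_
  · intro f hf
    have hf := (Finset.mem_filter.1 hf).2
    refine Finset.mem_coe.2 (Finset.mem_product.2 ⟨hf 0 1 (by simp), ?_⟩)
    exact Finset.mem_filter.2 ⟨Finset.mem_univ _, fun a b hab => hf _ _ (by simpa using hab)⟩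
  · intro f _ g _ h
    simp only [Prod.mk.injEq] at h
    funext i
    refine Fin.cases h.1.1 (fun i => Fin.cases h.1.2 (fun i => congrFun h.2 i) i) i

/-- The discrete Loomis–Whitney inequality for triples, by Cauchy–Schwarz over the first two
entries. -/
theorem card_pairwiseTuples_three_sq_le (G : Finset (α × α)) :
    (pairwiseTuples G 3).card ^ 2 ≤ G.card ^ 3 := by
  let d : α × α → Finset α := fun p =>
    Finset.univ.filter fun z => (p.1, z) ∈ G ∧ (p.2, z) ∈ G
  have hcard : (pairwiseTuples G 3).card ≤ ∑ p ∈ G, (d p).card := by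
    rw [← Finset.card_sigma]
    refine Finset.card_le_card_of_injOn
      (fun f => (⟨(f 0, f 1), f 2⟩ : Σ _ : α × α, α)) ?_ ?_
    · intro f hf
      have hf := (Finset.mem_filter.1 hf).2
      exact Finset.mem_coe.2 (Finset.mem_sigma.2 ⟨hf 0 1 (by decide),
        Finset.mem_filter.2 ⟨Finset.mem_univ _, hf 0 2 (by decide), hf 1 2 (by decide)⟩⟩)
    · intro f _ g _ h
      simp only [Sigma.mk.injEq, Prod.mk.injEq, heq_eq_eq] at h
      funext i
      fin_cases i
      · exact h.1.1
      · exact h.1.2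
      · exact h.2
  have hsq : ∑ p ∈ G, (d p).card ^ 2 ≤ G.card ^ 2 := by
    have h1 : ∑ p ∈ G, (d p).card ^ 2 = (G.sigma fun p => d p ×ˢ d p).card := by
      rw [Finset.card_sigma]
      exact Finset.sum_congr rfl fun p _ => by rw [Finset.card_product, sq]
    rw [h1, sq, ← Finset.card_product]
    refine Finset.card_le_card_of_injOn
      (fun t => ((t.1.1, t.2.1), (t.1.2, t.2.2))) ?_ ?_
    · intro t ht
      obtain ⟨-, ht⟩ := Finset.mem_sigma.1 ht
      obtain ⟨hz, hz'⟩ := Finset.mem_product.1 ht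
      exact Finset.mem_coe.2 (Finset.mem_product.2
        ⟨(Finset.mem_filter.1 hz).2.1, (Finset.mem_filter.1 hz').2.2⟩)
    · rintro ⟨⟨x, y⟩, z, z'⟩ _ ⟨⟨x', y'⟩, w, w'⟩ _ h
      simp only [Prod.mk.injEq] at h
      obtain ⟨⟨rfl, rfl⟩, rfl, rfl⟩ := h
      rfl
  calc (pairwiseTuples G 3).card ^ 2 ≤ (∑ p ∈ G, (d p).card) ^ 2 := Nat.pow_le_pow_left hcard 2
    _ ≤ G.card * ∑ p ∈ G, (d p).card ^ 2 := sq_sum_le_card_mul_sum_sq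
    _ ≤ G.card * G.card ^ 2 := Nat.mul_le_mul_left _ hsq
    _ = G.card ^ 3 := by ring

theorem card_pairwiseTuples_sq_le (G : Finset (α × α)) (m : ℕ) (hm : 2 ≤ m) :
    (pairwiseTuples G m).card ^ 2 ≤ G.card ^ m := by
  induction m using Nat.strong_induction_on with
  | _ m ih =>
    have hstep : ∀ k, (pairwiseTuples G k).card ^ 2 ≤ G.card ^ k →
        (pairwiseTuples G (k + 2)).card ^ 2 ≤ G.card ^ (k + 2) := fun k hk =>
      calc (pairwiseTuples G (k + 2)).card ^ 2
          ≤ (G.card * (pairwiseTuples G k).card) ^ 2 :=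
            Nat.pow_le_pow_left (card_pairwiseTuples_add_two_le G k) 2
        _ = G.card ^ 2 * (pairwiseTuples G k).card ^ 2 := mul_pow _ _ _
        _ ≤ G.card ^ 2 * G.card ^ k := Nat.mul_le_mul_left _ hk
        _ = G.card ^ (k + 2) := by ring
    obtain rfl | rfl | hm4 : m = 2 ∨ m = 3 ∨ 4 ≤ m := by omega
    · refine hstep 0 ?_
      have : (pairwiseTuples G 0).card ≤ 1 := (Finset.card_le_univ _).trans (by simp)
      simpa using this
    · exact card_pairwiseTuples_three_sq_le G
    · obtain ⟨k, rfl⟩ := Nat.exists_eq_add_of_le' (show 2 ≤ m by omega)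
      exact hstep k (ih k (by omega) (by omega))

end Pairwise

theorem ncard_dopeMatrices_sq_le (m n : ℕ) (hm : 2 ≤ m) :
    (dopeMatrices m n).ncard ^ 2 ≤ (2 * n + 1).choose n ^ m := by
  have hsub : dopeMatrices m n ⊆
      (pairwiseTuples (ballotPairs n) m : Set (Fin m → Fin (n + 1) → Fin 2)) := fun D hD =>
    Finset.mem_coe.2 (Finset.mem_filter.2
      ⟨Finset.mem_univ _, fun _ _ hab => rows_mem_ballotPairs hD hab⟩)
  have hcard : (dopeMatrices m n).ncard ≤ (pairwiseTuples (ballotPairs n) m).card := by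
    exact (Set.ncard_le_ncard hsub (Finset.finite_toSet _)).trans_eq
      (Set.ncard_coe_finset (pairwiseTuples (ballotPairs n) m))
  calc (dopeMatrices m n).ncard ^ 2
      ≤ (pairwiseTuples (ballotPairs n) m).card ^ 2 := Nat.pow_le_pow_left hcard 2
    _ ≤ (ballotPairs n).card ^ m := card_pairwiseTuples_sq_le _ m hm
    _ ≤ (2 * n + 1).choose n ^ m := Nat.pow_le_pow_left (card_ballotPairs_le n) m

/-! ### The Wallis bound and the final estimates -/

theorem pi_mul_centralBinom_sq_le (n : ℕ) :
    Real.pi * n * (n.centralBinom : ℝ) ^ 2 ≤ 16 ^ n := by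
  have h := Real.Wallis.le_W n
  have hfac : (n.centralBinom : ℝ) * ((n.factorial : ℝ) ^ 2) = ((2 * n).factorial : ℝ) := by
    have := Nat.choose_mul_factorial_mul_factorial (show n ≤ 2 * n by omega)
    rw [show 2 * n - n = n by omega] at this
    rw [Nat.centralBinom, ← this]
    push_cast
    ring
  have hc : (0 : ℝ) < n.centralBinom := by exact_mod_cast n.centralBinom_pos
  have hf : (0 : ℝ) < n.factorial := by exact_mod_cast n.factorial_pos
  have hn : (0 : ℝ) ≤ n := n.cast_nonneg
  rw [Real.Wallis.W_eq_factorial_ratio, ← hfac, pow_mul] at h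
  norm_num at h
  rw [mul_pow, ← pow_mul, show (16 : ℝ) ^ n * (n.factorial : ℝ) ^ 4 /
      ((n.centralBinom : ℝ) ^ 2 * (n.factorial : ℝ) ^ (2 * 2) * (2 * n + 1)) =
      16 ^ n / ((n.centralBinom : ℝ) ^ 2 * (2 * n + 1)) by field_simp,
    le_div_iff₀ (by positivity)] at h
  refine le_trans ?_ h
  have key : (n : ℝ) ≤ (2 * n + 1) ^ 2 / (4 * (n + 1)) := by
    rw [le_div_iff₀ (by positivity)]
    nlinarith
  calc Real.pi * n * (n.centralBinom : ℝ) ^ 2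
      ≤ Real.pi * ((2 * n + 1) ^ 2 / (4 * (n + 1))) * (n.centralBinom : ℝ) ^ 2 := by
        gcongr
    _ = _ := by field_simp; ring

theorem choose_two_mul_add_one_le (n : ℕ) (hn : 1 ≤ n) :
    ((2 * n + 1).choose n : ℝ) ≤ 2 / Real.sqrt (Real.pi * n) * 4 ^ n := by
  have hpos : 0 < Real.pi * n := mul_pos Real.pi_pos (by exact_mod_cast hn)
  have h1 : (2 * n + 1).choose n ≤ 2 * n.centralBinom := by
    rw [← Nat.choose_symm_half n, Nat.choose_succ_succ', Nat.centralBinom]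
    have := Nat.choose_le_centralBinom (n + 1) n
    rw [Nat.centralBinom] at this
    omega
  have h2 : Real.sqrt (Real.pi * n) * n.centralBinom ≤ 4 ^ n := by
    refine le_of_sq_le_sq ?_ (by positivity)
    rw [mul_pow, Real.sq_sqrt hpos.le, ← pow_mul, mul_comm n 2, pow_mul]
    norm_num
    exact pi_mul_centralBinom_sq_le n
  rw [div_mul_eq_mul_div, le_div_iff₀ (Real.sqrt_pos.2 hpos)]
  have h1' : ((2 * n + 1).choose n : ℝ) ≤ 2 * n.centralBinom := by exact_mod_cast h1
  calc ((2 * n + 1).choose n : ℝ) * Real.sqrt (Real.pi * n)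
      ≤ 2 * n.centralBinom * Real.sqrt (Real.pi * n) := by gcongr
    _ = 2 * (Real.sqrt (Real.pi * n) * n.centralBinom) := by ring
    _ ≤ 2 * 4 ^ n := by gcongr

theorem corollary3 (m n : ℕ) (hm : 2 ≤ m) (hn : 1 ≤ n) :
    ((dopeMatrices m n).ncard : ℝ) ≤ ((2 * n + 1).choose n : ℝ) ^ ((m : ℝ) / 2) ∧
    ((2 * n + 1).choose n : ℝ) ^ ((m : ℝ) / 2) ≤
      (2 / Real.sqrt (Real.pi * (n : ℝ))) ^ ((m : ℝ) / 2) * (2 : ℝ) ^ (m * n) := by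
  constructor
  · refine le_of_sq_le_sq ?_ (by positivity)
    rw [← Real.rpow_natCast (_ ^ _) 2, ← Real.rpow_mul (by positivity), Nat.cast_two,
      div_mul_cancel₀ _ two_ne_zero, Real.rpow_natCast]
    exact_mod_cast ncard_dopeMatrices_sq_le m n hm
  · have h4 : ((4 : ℝ) ^ n) ^ ((m : ℝ) / 2) = 2 ^ (m * n) := by
      rw [show (4 : ℝ) ^ n = 2 ^ (2 * n) by rw [pow_mul]; norm_num, ← Real.rpow_natCast,
        ← Real.rpow_natCast, ← Real.rpow_mul zero_le_two]
      congr 1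
      push_cast
      ring
    rw [← h4, ← Real.mul_rpow (by positivity) (by positivity)]
    exact Real.rpow_le_rpow (by positivity) (choose_two_mul_add_one_le n hn) (by positivity)
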